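/- For complex numbers $a,b,c,d,e$ consider the sequence $(T(n))_{n\ge 0}$ determined by $T(0)=1$ and the four-term recurrence $$(n+1)^3T(n+1)=(2n+1)(an^2+an+b)\,T(n)+n(cn^2+d)\,T(n-1)+e\,n(n-1)(2n-1)\,T(n-2)\qquad(n\ge 0);$$ the single initial condition suffices, because the coefficient of $T(n-1)$ vanishes at $n=0$ and the coefficient of $T(n-2)$ vanishes at $n=0$ and $n=1$. Let $T_{15A},T_{15B},T_{15C},T_{15\overline{C}}$ be the sequences obtained for \begin{align*} T_{15A}:&\quad (a,b,c,d,e)=(7,\,3,\,-29,\,-4,\,30),\\ T_{15B}:&\quad (a,b,c,d,e)=(-17,\,-9,\,-389,\,-76,\,-750),\\ T_{15C}:&\quad (a,b,c,d,e)=(5+4i,\,2+2i,\,31-60i,\,5-8i,\,-40-30i),\\ T_{15\overline{C}}:&\quad (a,b,c,d,e)=(5-4i,\,2-2i,\,31+60i,\,5+8i,\,-40+30i). \end{align*} **Theorem.** For all complex $w$ in a neighborhood of $w=0$ the following four series converge absolutely and \begin{align*} \sum_{n=0}^\infty T_{15A}(n)\left(\frac{w}{1+w-w^2}\right)^{n+1}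 &=\sum_{n=0}^\infty T_{15B}(n)\left(\frac{w}{1-11w-w^2}\right)^{n+1}\\ &=\sum_{n=0}^\infty T_{15C}(n)\left(\frac{w}{1+2iw-w^2}\right)^{n+1}\\ &=\sum_{n=0}^\infty T_{15\overline{C}}(n)\left(\frac{w}{1-2iw-w^2}\right)^{n+1}. \end{align*} -/

import Mathlib

/-- The sequence determined by `T 0 = 1` and the four-term recurrence
`(n+1)^3 T(n+1) = (2n+1)(a n^2 + a n + b) T(n) + n (c n^2 + d) T(n-1) + e n (n-1) (2n-1) T(n-2)`,
solved for the leading term. The coefficient of `T(n-1)` vanishes for `n = 0`, and that of `T(n-2)`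
for `n = 0` and `n = 1`, so the terms with negative index do not occur and the first two steps are
listed separately. -/
noncomputable def fourTermSeq (a b c d e : ℂ) : ℕ → ℂ
  | 0 => 1
  | 1 => b
  | 2 => (3 * (2 * a + b) * fourTermSeq a b c d e 1 + (c + d) * fourTermSeq a b c d e 0) / 8
  | (n + 3) =>
      ((2 * ((n : ℂ) + 2) + 1) * (a * ((n : ℂ) + 2) ^ 2 + a * ((n : ℂ) + 2) + b)
            * fourTermSeq a b c d e (n + 2)
          + ((n : ℂ) + 2) * (c * ((n : ℂ) + 2) ^ 2 + d) * fourTermSeq a b c d e (n + 1)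
          + e * ((n : ℂ) + 2) * (2 * ((n : ℂ) + 2) - 1) * (((n : ℂ) + 2) - 1)
            * fourTermSeq a b c d e n)
        / ((n : ℂ) + 3) ^ 3

theorem fourTermSeq_zero (a b c d e : ℂ) : fourTermSeq a b c d e 0 = 1 := by
  simp [fourTermSeq]

/-- The four-term recurrence, for every `n ≥ 0`. The truncated subtractions `n - 1` and `n - 2` in
the indices are harmless, since they are truncated only where the coefficient is zero. -/
theorem fourTermSeq_rec (a b c d e : ℂ) (n : ℕ) :
    ((n : ℂ) + 1) ^ 3 * fourTermSeq a b c d e (n + 1) =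
      (2 * (n : ℂ) + 1) * (a * (n : ℂ) ^ 2 + a * (n : ℂ) + b) * fourTermSeq a b c d e n
        + (n : ℂ) * (c * (n : ℂ) ^ 2 + d) * fourTermSeq a b c d e (n - 1)
        + e * (n : ℂ) * (2 * (n : ℂ) - 1) * ((n : ℂ) - 1) * fourTermSeq a b c d e (n - 2) := by
  match n with
  | 0 => simp [fourTermSeq]
  | 1 => simp [fourTermSeq]; ring
  | (m + 2) =>
    have h : ((m : ℂ) + 3) ≠ 0 := by exact_mod_cast (Nat.succ_ne_zero (m + 2))
    have h1 : m + 2 - 1 = m + 1 := rfl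
    have h2 : m + 2 - 2 = m := rfl
    have h3 : m + 2 + 1 = m + 3 := rfl
    rw [h1, h2, h3, fourTermSeq]
    push_cast
    rw [show (m : ℂ) + 2 + 1 = (m : ℂ) + 3 by ring, mul_div_cancel₀ _ (pow_ne_zero 3 h)]

/-- `T_{15A}`, the case `ε = 1`. -/
noncomputable def T15A : ℕ → ℂ := fourTermSeq 7 3 (-29) (-4) 30

/-- `T_{15B}`, the case `ε = -11`. -/
noncomputable def T15B : ℕ → ℂ := fourTermSeq (-17) (-9) (-389) (-76) (-750)

/-- `T_{15C}`, the case `ε = 2i`. -/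
noncomputable def T15C : ℕ → ℂ :=
  fourTermSeq (5 + 4 * Complex.I) (2 + 2 * Complex.I) (31 - 60 * Complex.I) (5 - 8 * Complex.I)
    (-40 - 30 * Complex.I)

/-- `T_{15C̄}`, the case `ε = -2i`. -/
noncomputable def T15Cbar : ℕ → ℂ :=
  fourTermSeq (5 - 4 * Complex.I) (2 - 2 * Complex.I) (31 + 60 * Complex.I) (5 + 8 * Complex.I)
    (-40 + 30 * Complex.I)

/-- The `n`-th term of `∑ T(n) (w / (1 + ε w - w²))^(n+1)`. -/
noncomputable def genTerm (T : ℕ → ℂ) (ε w : ℂ) (n : ℕ) : ℂ :=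
  T n * (w / (1 + ε * w - w ^ 2)) ^ (n + 1)

/-!
Let `φ` be the linear functional on polynomials with `φ (X ^ n) = T n`. The recurrence for `T` says
that `φ` annihilates the image of a third-order differential operator `L` with leading coefficient
`X (X³ - 2 a X² - c X - 2 e)`. If `-δ` is a root of this quartic, then expanding the coefficients of
`L` in powers of `V = X + δ` gives an operator of the same shape with other parameters, and so
`n ↦ φ (V ^ n)`, which is the binomial transform of `T`, again satisfies a four-term recurrence. For
`T_{15A}` the quartic is `X (X - 12) (X² - 2 X + 5)`, and its roots `12` and `1 ∓ 2i` yield the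
other three sequences.

A binomial transform acts on generating functions by `x ↦ x / (1 - δ x)`, and this substitution
turns `w / (1 + ε w - w²)` into `w / (1 + (ε - δ) w - w²)`.
-/

open Polynomial Filter Topology
open Finset.HasAntidiagonal (antidiagonal)

section Umbral

variable {R : Type*}

/-- The binomial transform `n ↦ ∑ k, (n choose k) δ ^ (n - k) T k`, written as a sum over
`k + j = n` to avoid the subtraction. -/
def binomialTransform [Semiring R] (δ : R) (T : ℕ → R) (n : ℕ) : R :=
  ∑ p ∈ antidiagonal n, (n.choose p.1 : R) * δ ^ p.2 * T p.1

/-- The linear functional on polynomials whose moments are `T`, that is, `X ^ n ↦ T n`. -/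
noncomputable def momentFunctional [Semiring R] (T : ℕ → R) : R[X] →ₗ[R] R :=
  lsum fun n => LinearMap.toSpanSingleton R R (T n)

theorem momentFunctional_X_pow [Semiring R] (T : ℕ → R) (n : ℕ) :
    momentFunctional T (X ^ n) = T n := by
  simp [momentFunctional, lsum_apply, ← monomial_one_right_eq_X_pow]

theorem momentFunctional_C_mul [Semiring R] (T : ℕ → R) (z : R) (p : R[X]) :
    momentFunctional T (C z * p) = z * momentFunctional T p := by
  rw [← smul_eq_C_mul, map_smul, smul_eq_mul]

theorem momentFunctional_X_add_C_pow [CommSemiring R] (T : ℕ → R) (δ : R) (n : ℕ) :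
    momentFunctional T ((X + C δ) ^ n) = binomialTransform δ T n := by
  rw [(Commute.all _ _).add_pow', map_sum]
  refine Finset.sum_congr rfl fun p _ => ?_
  rw [map_nsmul, ← C_pow, mul_comm (X ^ p.1), momentFunctional_C_mul, momentFunctional_X_pow,
    nsmul_eq_mul, mul_assoc]

variable [CommRing R]

/-- The four-term recurrence as a property of a sequence `T`. The indices `n - 1` and `n - 2` are
truncated only where the coefficients vanish. -/
def IsFourTermRec (a b c d e : R) (T : ℕ → R) : Prop :=
  ∀ n : ℕ, ((n : R) + 1) ^ 3 * T (n + 1) =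
    (2 * (n : R) + 1) * (a * (n : R) ^ 2 + a * (n : R) + b) * T n
      + (n : R) * (c * (n : R) ^ 2 + d) * T (n - 1)
      + e * (n : R) * (2 * (n : R) - 1) * ((n : R) - 1) * T (n - 2)

/-- The differential operator adjoint to the four-term recurrence: on powers of a variable `V` (that
is, `X` or a translate of it) it acts by the recurrence, so that a functional for which `V ^ n` has
value `T n` vanishes on its image. With `θ = V d/dV` it is
`V (θ + 1) ^ 3 - (2 θ + 1) (a θ ^ 2 + a θ + b) - d/dV (c θ ^ 2 + d) - e (d/dV) ^ 2 (2 θ - 1)`. -/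
noncomputable def recurrenceOp (a b c d e : R) (V : R[X]) : R[X] →ₗ[R] R[X] :=
  LinearMap.mulLeft R (V ^ 4 - C (2 * a) * V ^ 3 - C c * V ^ 2 - C (2 * e) * V) ∘ₗ derivative ^ 3
    + LinearMap.mulLeft R (6 * V ^ 3 - C (9 * a) * V ^ 2 - C (3 * c) * V - C (3 * e)) ∘ₗ
      derivative ^ 2
    + LinearMap.mulLeft R (7 * V ^ 2 - C (6 * a + 2 * b) * V - C (c + d)) ∘ₗ derivative
    + LinearMap.mulLeft R (V - C b)

theorem recurrenceOp_apply (a b c d e : R) (V p : R[X]) :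
    recurrenceOp a b c d e V p =
      (V ^ 4 - C (2 * a) * V ^ 3 - C c * V ^ 2 - C (2 * e) * V) * derivative^[3] p
        + (6 * V ^ 3 - C (9 * a) * V ^ 2 - C (3 * c) * V - C (3 * e)) * derivative^[2] p
        + (7 * V ^ 2 - C (6 * a + 2 * b) * V - C (c + d)) * derivative p
        + (V - C b) * p := by
  simp only [recurrenceOp, LinearMap.add_apply, LinearMap.comp_apply, LinearMap.mulLeft_apply,
    Module.End.pow_apply]

variable {a b c d e δ : R} {T : ℕ → R}

theorem recurrenceOp_X_add_C_pow (a b c d e δ : R) (n : ℕ) :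
    recurrenceOp a b c d e (X + C δ) ((X + C δ) ^ n) =
      C (((n : R) + 1) ^ 3) * (X + C δ) ^ (n + 1)
        - C ((2 * (n : R) + 1) * (a * (n : R) ^ 2 + a * (n : R) + b)) * (X + C δ) ^ n
        - C ((n : R) * (c * (n : R) ^ 2 + d)) * (X + C δ) ^ (n - 1)
        - C (e * (n : R) * (2 * (n : R) - 1) * ((n : R) - 1)) * (X + C δ) ^ (n - 2) := by
  simp only [recurrenceOp_apply, iterate_derivative_X_add_pow, derivative_X_add_C_pow]
  generalize (X : R[X]) + C δ = V
  match n with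
  | 0 => simp
  | 1 =>
    simp only [Nat.descFactorial, Nat.reduceSub, Nat.cast_one, zero_mul, mul_zero, one_mul,
      zero_smul, map_add, map_mul, map_sub, map_pow, map_one, C_ofNat]
    ring
  | 2 =>
    simp only [Nat.descFactorial, Nat.reduceSub, Nat.reduceMul, zero_mul, mul_zero,
      nsmul_eq_mul, Nat.cast_ofNat, Nat.cast_zero, map_add, map_mul, map_sub, map_pow, map_one,
      C_ofNat]
    ring
  | m + 3 =>
    simp only [Nat.descFactorial, Nat.reduceSubDiff, Nat.add_one_sub_one, tsub_zero,
      add_tsub_cancel_right, nsmul_eq_mul, Nat.cast_mul, Nat.cast_add, Nat.cast_one,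
      Nat.cast_ofNat, map_add, map_mul, map_sub, map_pow, map_one, map_natCast, C_ofNat]
    ring

theorem recurrenceOp_X_eq_X_add_C
    (hδ : δ * (δ ^ 3 + 2 * a * δ ^ 2 - c * δ + 2 * e) = 0) (p : R[X]) :
    recurrenceOp a b c d e X p =
      recurrenceOp (a + 2 * δ) (b + δ) (c - 6 * δ ^ 2 - 6 * a * δ) (d - δ ^ 2 - 2 * b * δ)
        (e + 2 * δ ^ 3 + 3 * a * δ ^ 2 - c * δ) (X + C δ) p := by
  have hC := congrArg (C : R → R[X]) hδ
  simp only [recurrenceOp_apply, map_mul, map_add, map_sub, map_pow, map_zero, C_ofNat] at hC ⊢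
  linear_combination derivative^[3] p * hC

theorem IsFourTermRec.momentFunctional_recurrenceOp (hT : IsFourTermRec a b c d e T) (p : R[X]) :
    momentFunctional T (recurrenceOp a b c d e X p) = 0 := by
  suffices h : momentFunctional T ∘ₗ recurrenceOp a b c d e X = 0 from LinearMap.congr_fun h p
  refine lhom_ext' fun n => LinearMap.ext_ring ?_
  have h := recurrenceOp_X_add_C_pow a b c d e 0 n
  rw [C_0, add_zero] at h
  simp only [LinearMap.comp_apply, monomial_one_right_eq_X_pow, h, map_sub, momentFunctional_C_mul,
    momentFunctional_X_pow, LinearMap.zero_apply]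
  linear_combination hT n

theorem IsFourTermRec.binomialTransform (hT : IsFourTermRec a b c d e T)
    (hδ : δ * (δ ^ 3 + 2 * a * δ ^ 2 - c * δ + 2 * e) = 0) :
    IsFourTermRec (a + 2 * δ) (b + δ) (c - 6 * δ ^ 2 - 6 * a * δ) (d - δ ^ 2 - 2 * b * δ)
      (e + 2 * δ ^ 3 + 3 * a * δ ^ 2 - c * δ) (binomialTransform δ T) := by
  intro n
  have h := hT.momentFunctional_recurrenceOp ((X + C δ) ^ n)
  rw [recurrenceOp_X_eq_X_add_C hδ, recurrenceOp_X_add_C_pow] at h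
  simp only [map_sub, momentFunctional_C_mul, momentFunctional_X_add_C_pow] at h
  linear_combination h

end Umbral

section Growth

theorem exists_norm_eval_natCast_le {R : Type*} [SeminormedRing R] [NormOneClass R] {p : R[X]}
    {d : ℕ} (hp : p.natDegree ≤ d) :
    ∃ M : ℝ, ∀ n : ℕ, ‖p.eval (n : R)‖ ≤ M * ((n : ℝ) + 1) ^ d := by
  refine ⟨∑ i ∈ Finset.range (d + 1), ‖p.coeff i‖, fun n => ?_⟩
  rw [eval_eq_sum_range' (Nat.lt_succ_of_le hp), Finset.sum_mul]
  refine norm_sum_le_of_le _ fun i hi => ?_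
  have hn : ‖(n : R) ^ i‖ ≤ ((n : ℝ) + 1) ^ d :=
    calc ‖(n : R) ^ i‖ ≤ ‖(n : R)‖ ^ i := norm_pow_le _ _
      _ ≤ ((n : ℝ) + 1) ^ i := by
        gcongr
        simpa using (Nat.norm_cast_le n).trans (by simp)
      _ ≤ ((n : ℝ) + 1) ^ d :=
        pow_le_pow_right₀ (by simp) (Nat.lt_succ_iff.mp (Finset.mem_range.mp hi))
  exact (norm_mul_le _ _).trans (by gcongr)

theorem exists_norm_le_mul_pow_of_norm_succ_le {E : Type*} [SeminormedAddGroup E] {T : ℕ → E}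
    {M : ℝ} (h : ∀ (n : ℕ) (B : ℝ), (∀ k ≤ n, ‖T k‖ ≤ B) → ‖T (n + 1)‖ ≤ M * B) :
    ∃ K : ℝ, ∀ n, ‖T n‖ ≤ ‖T 0‖ * K ^ n := by
  refine ⟨max 1 M, fun n => ?_⟩
  induction n using Nat.strong_induction_on with
  | _ n ih =>
    match n with
    | 0 => simp
    | n + 1 =>
      have hB : ∀ k ≤ n, ‖T k‖ ≤ ‖T 0‖ * max 1 M ^ n := fun k hk =>
        (ih k (Nat.lt_succ_of_le hk)).trans (by gcongr; exact le_max_left 1 M)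
      calc ‖T (n + 1)‖ ≤ M * (‖T 0‖ * max 1 M ^ n) := h n _ hB
        _ ≤ max 1 M * (‖T 0‖ * max 1 M ^ n) := by gcongr; exact le_max_right 1 M
        _ = ‖T 0‖ * max 1 M ^ (n + 1) := by ring

theorem IsFourTermRec.exists_norm_le {𝕜 : Type*} [RCLike 𝕜] {a b c d e : 𝕜} {T : ℕ → 𝕜}
    (hT : IsFourTermRec a b c d e T) : ∃ K : ℝ, ∀ n, ‖T n‖ ≤ ‖T 0‖ * K ^ n := by
  obtain ⟨M₁, h₁⟩ := exists_norm_eval_natCast_le (d := 3)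
    (p := (2 * X + 1) * (C a * X ^ 2 + C a * X + C b)) (by compute_degree)
  obtain ⟨M₂, h₂⟩ := exists_norm_eval_natCast_le (d := 3)
    (p := X * (C c * X ^ 2 + C d)) (by compute_degree)
  obtain ⟨M₃, h₃⟩ := exists_norm_eval_natCast_le (d := 3)
    (p := C e * X * (2 * X - 1) * (X - 1)) (by compute_degree)
  refine exists_norm_le_mul_pow_of_norm_succ_le (M := M₁ + M₂ + M₃) fun n B hB => ?_
  simp only [eval_mul, eval_add, eval_sub, eval_pow, eval_C, eval_X, eval_one, eval_ofNat]
    at h₁ h₂ h₃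
  have hn : ‖((n : 𝕜) + 1) ^ 3‖ = ((n : ℝ) + 1) ^ 3 := by
    rw [norm_pow, ← Nat.cast_add_one, RCLike.norm_natCast, Nat.cast_add_one]
  have hpos : (0 : ℝ) < ((n : ℝ) + 1) ^ 3 := by positivity
  refine le_of_mul_le_mul_left ?_ hpos
  calc ((n : ℝ) + 1) ^ 3 * ‖T (n + 1)‖ = ‖((n : 𝕜) + 1) ^ 3 * T (n + 1)‖ := by rw [norm_mul, hn]
    _ ≤ M₁ * ((n : ℝ) + 1) ^ 3 * B + M₂ * ((n : ℝ) + 1) ^ 3 * B + M₃ * ((n : ℝ) + 1) ^ 3 * B := by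
      rw [hT n]
      refine norm_add₃_le.trans (add_le_add_three ?_ ?_ ?_)
      · exact norm_mul_le_of_le (h₁ n) (hB _ le_rfl)
      · exact norm_mul_le_of_le (h₂ n) (hB _ (Nat.sub_le n 1))
      · exact norm_mul_le_of_le (h₃ n) (hB _ (Nat.sub_le n 2))
    _ = ((n : ℝ) + 1) ^ 3 * ((M₁ + M₂ + M₃) * B) := by ring

end Growth

section GeneratingFunction

variable {𝕜 : Type*} [NormedField 𝕜]

theorem eventually_summable_norm_mul_pow_succ {T : ℕ → 𝕜} {A K : ℝ}
    (hT : ∀ n, ‖T n‖ ≤ A * K ^ n) :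
    ∀ᶠ z in 𝓝 (0 : 𝕜), Summable fun n => ‖T n * z ^ (n + 1)‖ := by
  have hsmall : ∀ᶠ z in 𝓝 (0 : 𝕜), ‖K * ‖z‖‖ < 1 :=
    ContinuousAt.eventually_lt (by fun_prop) continuousAt_const (by simp)
  filter_upwards [hsmall] with z hz
  refine .of_nonneg_of_le (fun n => norm_nonneg _) (fun n => ?_)
    ((summable_geometric_of_norm_lt_one hz).mul_left (A * ‖z‖))
  calc ‖T n * z ^ (n + 1)‖ = ‖T n‖ * ‖z‖ ^ (n + 1) := by rw [norm_mul, norm_pow]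
    _ ≤ A * K ^ n * ‖z‖ ^ (n + 1) := by gcongr; exact hT n
    _ = A * ‖z‖ * (K * ‖z‖) ^ n := by ring

theorem hasSum_choose_mul_pow_mul_pow {δ x : 𝕜} (hδx : ‖δ * x‖ < 1) (k : ℕ) :
    HasSum (fun j => ((k + j).choose k : 𝕜) * δ ^ j * x ^ (k + j + 1))
      ((x / (1 - δ * x)) ^ (k + 1)) := by
  have h := (hasSum_choose_mul_geometric_of_norm_lt_one k hδx).mul_left (x ^ (k + 1))
  rw [mul_one_div, ← div_pow] at h
  refine h.congr_fun fun j => ?_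
  rw [add_comm k j]
  ring

variable [CompleteSpace 𝕜]

theorem summable_choose_mul_pow_mul_pow {T : ℕ → 𝕜} {δ x : 𝕜} (hδx : ‖δ‖ * ‖x‖ < 1)
    (hT : Summable fun n => ‖T n‖ * (‖x‖ / (1 - ‖δ‖ * ‖x‖)) ^ (n + 1)) :
    Summable fun p : ℕ × ℕ =>
      T p.1 * (((p.1 + p.2).choose p.1 : 𝕜) * δ ^ p.2 * x ^ (p.1 + p.2 + 1)) := by
  have hrow (k : ℕ) := (hasSum_choose_mul_pow_mul_pow (δ := ‖δ‖) (x := ‖x‖)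
    (by simpa using hδx) k).mul_left ‖T k‖
  have hmajorant : Summable fun p : ℕ × ℕ =>
      ‖T p.1‖ * (((p.1 + p.2).choose p.1 : ℝ) * ‖δ‖ ^ p.2 * ‖x‖ ^ (p.1 + p.2 + 1)) := by
    rw [summable_prod_of_nonneg fun p => by positivity]
    exact ⟨fun k => (hrow k).summable, by simpa only [(hrow _).tsum_eq] using hT⟩
  refine hmajorant.of_norm_bounded fun p => ?_
  simp only [norm_mul, norm_pow]
  gcongr
  simpa using Nat.norm_cast_le (α := 𝕜) ((p.1 + p.2).choose p.1)

theorem hasSum_binomialTransform {T : ℕ → 𝕜} {δ x : 𝕜} (hδx : ‖δ‖ * ‖x‖ < 1)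
    (hT : Summable fun n => ‖T n‖ * (‖x‖ / (1 - ‖δ‖ * ‖x‖)) ^ (n + 1)) :
    HasSum (fun n => binomialTransform δ T n * x ^ (n + 1))
      (∑' n, T n * (x / (1 - δ * x)) ^ (n + 1)) := by
  have hdouble := (summable_choose_mul_pow_mul_pow hδx hT).hasSum
  have hrows := hdouble.prod_fiberwise fun k =>
    (hasSum_choose_mul_pow_mul_pow (by rwa [norm_mul]) k).mul_left (T k)
  have hdiagonals := (Finset.HasAntidiagonal.sigmaAntidiagonalEquivProd.hasSum_iff.mpr
    hdouble).sigma fun n => hasSum_fintype _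
  rw [hrows.tsum_eq]
  refine hdiagonals.congr_fun fun n => ?_
  simp only [binomialTransform, Finset.sum_mul, Function.comp_apply,
    Finset.HasAntidiagonal.sigmaAntidiagonalEquivProd_apply]
  rw [← Finset.sum_coe_sort]
  refine Finset.sum_congr rfl fun p _ => ?_
  rw [Finset.HasAntidiagonal.mem_antidiagonal.mp p.2]
  ring

theorem eventually_hasSum_binomialTransform {T : ℕ → 𝕜} {A K : ℝ}
    (hT : ∀ n, ‖T n‖ ≤ A * K ^ n) (δ : 𝕜) :
    ∀ᶠ x in 𝓝 (0 : 𝕜), HasSum (fun n => binomialTransform δ T n * x ^ (n + 1))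
      (∑' n, T n * (x / (1 - δ * x)) ^ (n + 1)) := by
  have hsmall : ∀ᶠ x in 𝓝 (0 : 𝕜), ‖δ‖ * ‖x‖ < 1 :=
    ContinuousAt.eventually_lt (by fun_prop) continuousAt_const (by simp)
  have hradius : Tendsto (fun x : 𝕜 => ‖x‖ / (1 - ‖δ‖ * ‖x‖)) (𝓝 0) (𝓝 0) := by
    have h : ContinuousAt (fun x : 𝕜 => ‖x‖ / (1 - ‖δ‖ * ‖x‖)) 0 :=
      continuousAt_id.norm.div (by fun_prop) (by simp)
    simpa [ContinuousAt] using h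
  have hsummable := hradius.eventually
    (eventually_summable_norm_mul_pow_succ (T := fun n => ‖T n‖) (by simpa using hT))
  filter_upwards [hsmall, hsummable] with x hx hTx
  exact hasSum_binomialTransform hx hTx.of_norm

end GeneratingFunction

theorem isFourTermRec_fourTermSeq (a b c d e : ℂ) :
    IsFourTermRec a b c d e (fourTermSeq a b c d e) :=
  fourTermSeq_rec a b c d e

theorem IsFourTermRec.eq_fourTermSeq {a b c d e : ℂ} {T : ℕ → ℂ} (hT : IsFourTermRec a b c d e T)
    (hT₀ : T 0 = 1) : T = fourTermSeq a b c d e := by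
  funext n
  induction n using Nat.strong_induction_on with
  | _ n ih =>
    match n with
    | 0 => rw [hT₀, fourTermSeq_zero]
    | n + 1 =>
      refine mul_left_cancel₀ (pow_ne_zero 3 (Nat.cast_add_one_ne_zero n)) ?_
      rw [hT n, fourTermSeq_rec, ih n (by lia), ih (n - 1) (by lia), ih (n - 2) (by lia)]

theorem binomialTransform_fourTermSeq {a b c d e δ : ℂ}
    (hδ : δ * (δ ^ 3 + 2 * a * δ ^ 2 - c * δ + 2 * e) = 0) :
    binomialTransform δ (fourTermSeq a b c d e) =
      fourTermSeq (a + 2 * δ) (b + δ) (c - 6 * δ ^ 2 - 6 * a * δ) (d - δ ^ 2 - 2 * b * δ)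
        (e + 2 * δ ^ 3 + 3 * a * δ ^ 2 - c * δ) :=
  ((isFourTermRec_fourTermSeq a b c d e).binomialTransform hδ).eq_fourTermSeq
    (by simp [binomialTransform, fourTermSeq_zero])

theorem T15B_eq_binomialTransform : T15B = binomialTransform (-11 - 1) T15A := by
  rw [T15A, binomialTransform_fourTermSeq (by norm_num), T15B]
  norm_num

theorem T15C_eq_binomialTransform : T15C = binomialTransform (2 * Complex.I - 1) T15A := by
  have hI : Complex.I ^ 2 = -1 := Complex.I_sq
  rw [T15A, binomialTransform_fourTermSeq, T15C]
  · congr 1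
    · ring
    · ring
    · linear_combination 24 * hI
    · linear_combination 4 * hI
    · linear_combination (-16 * Complex.I - 60) * hI
  · linear_combination 4 * (2 * Complex.I - 1) * (2 * Complex.I + 11) * hI

theorem T15Cbar_eq_binomialTransform : T15Cbar = binomialTransform (-2 * Complex.I - 1) T15A := by
  have hI : Complex.I ^ 2 = -1 := Complex.I_sq
  rw [T15A, binomialTransform_fourTermSeq, T15Cbar]
  · congr 1
    · ring
    · ring
    · linear_combination 24 * hI
    · linear_combination 4 * hI
    · linear_combination (16 * Complex.I - 60) * hI
  · linear_combination 4 * (-2 * Complex.I - 1) * (-2 * Complex.I + 11) * hI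

section Substitution

theorem tendsto_div_one_add_mul_sub_sq {𝕜 : Type*} [NormedField 𝕜] (ε : 𝕜) :
    Tendsto (fun w : 𝕜 => w / (1 + ε * w - w ^ 2)) (𝓝 0) (𝓝 0) := by
  have h : ContinuousAt (fun w : 𝕜 => w / (1 + ε * w - w ^ 2)) 0 :=
    continuousAt_id.div (by fun_prop) (by simp)
  simpa [ContinuousAt] using h

theorem moebius_div_one_add_mul_sub_sq {F : Type*} [Field F] {ε ε' w : F}
    (hw : 1 + ε' * w - w ^ 2 ≠ 0) :
    w / (1 + ε' * w - w ^ 2) / (1 - (ε' - ε) * (w / (1 + ε' * w - w ^ 2))) =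
      w / (1 + ε * w - w ^ 2) := by
  have h : 1 - (ε' - ε) * (w / (1 + ε' * w - w ^ 2)) =
      (1 + ε * w - w ^ 2) / (1 + ε' * w - w ^ 2) := by
    field_simp
    ring
  rw [h, div_div_div_cancel_right₀ hw]

variable {T : ℕ → ℂ} {A K : ℝ}

theorem eventually_summable_genTerm (hT : ∀ n, ‖T n‖ ≤ A * K ^ n) (ε : ℂ) :
    ∀ᶠ w in 𝓝 0, Summable (genTerm T ε w) :=
  ((tendsto_div_one_add_mul_sub_sq ε).eventually
    (eventually_summable_norm_mul_pow_succ hT)).mono fun _ h => h.of_norm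

theorem eventually_hasSum_genTerm_binomialTransform (hT : ∀ n, ‖T n‖ ≤ A * K ^ n) (ε ε' : ℂ) :
    ∀ᶠ w in 𝓝 0, HasSum (genTerm (binomialTransform (ε' - ε) T) ε' w)
      (∑' n, genTerm T ε w n) := by
  have hne : ∀ᶠ w in 𝓝 (0 : ℂ), 1 + ε' * w - w ^ 2 ≠ 0 :=
    ContinuousAt.eventually_ne (by fun_prop) (by simp)
  filter_upwards [hne, (tendsto_div_one_add_mul_sub_sq ε').eventually
    (eventually_hasSum_binomialTransform hT (ε' - ε))] with w hw hsum
  rw [moebius_div_one_add_mul_sub_sq hw] at hsum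
  exact hsum

end Substitution

theorem mainTheorem7 :
    ∀ᶠ w : ℂ in nhds 0,
      (Summable (genTerm T15A 1 w) ∧ Summable (genTerm T15B (-11) w) ∧
        Summable (genTerm T15C (2 * Complex.I) w) ∧
        Summable (genTerm T15Cbar (-2 * Complex.I) w)) ∧
      ∑' n, genTerm T15A 1 w n = ∑' n, genTerm T15B (-11) w n ∧
      ∑' n, genTerm T15B (-11) w n = ∑' n, genTerm T15C (2 * Complex.I) w n ∧
      ∑' n, genTerm T15C (2 * Complex.I) w n =
        ∑' n, genTerm T15Cbar (-2 * Complex.I) w n := by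
  obtain ⟨K, hK⟩ : ∃ K : ℝ, ∀ n, ‖T15A n‖ ≤ ‖T15A 0‖ * K ^ n :=
    (isFourTermRec_fourTermSeq 7 3 (-29) (-4) 30).exists_norm_le
  have hA := eventually_summable_genTerm hK 1
  have hB := eventually_hasSum_genTerm_binomialTransform hK 1 (-11)
  have hC := eventually_hasSum_genTerm_binomialTransform hK 1 (2 * Complex.I)
  have hCbar := eventually_hasSum_genTerm_binomialTransform hK 1 (-2 * Complex.I)
  rw [← T15B_eq_binomialTransform] at hB
  rw [← T15C_eq_binomialTransform] at hC
  rw [← T15Cbar_eq_binomialTransform] at hCbar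
  filter_upwards [hA, hB, hC, hCbar] with w hA hB hC hCbar
  exact ⟨⟨hA, hB.summable, hC.summable, hCbar.summable⟩, hB.tsum_eq.symm,
    hB.tsum_eq.trans hC.tsum_eq.symm, hC.tsum_eq.trans hCbar.tsum_eq.symm⟩
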